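/- Let $p$ be a prime, $G$ a finite $p$-group, $K$ a finite extension of $\mathbb{Q}_p$ with ring of integers $R$, and $\pi$ a uniformizing element of $R$. For a finitely generated $RG$-module $B$ put $r_R(B)=\dim_{R/(\pi)} B/(\pi B+[B,G])$, where $[B,G]$ is the submodule generated by the elements $gb-b$ with $g\in G$, $b\in B$. An $RG$-module $A$ is called cohomologically trivial if the Tate cohomology groups $\hat H^n(S,A)$ vanish for all subgroups $S\le G$ and all integers $n$. Let $A$ be a finite $RG$-module. Then the following two statements are equivalent: (i) $A$ is cohomologically trivial; (ii) for every short exact sequence $0\to M\to L\to A\to 0$ of $RG$-modules with $L$ free of finite rank, one has $r_R(M)=r_R(L)$. -/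

import Mathlib

universe u

/-- A representation `ρ` of a finite group `G` is cohomologically trivial if the Tate cohomology
groups `Ĥⁿ(S, V)` vanish for all subgroups `S ≤ G` and all integers `n`. The underlying abelian
groups of the Tate complex are the groups of inhomogeneous (co)chains with values in `V`; they and
the differentials depend only on the additive group `V` with its `G`-action, so that the base ring
`k` (for instance `ℤ`) plays no role in the vanishing. -/
def IsCohomologicallyTrivial {k G : Type u} [CommRing k] [Group G] [Finite G]
    {V : Type u} [AddCommGroup V] [Module k V] (ρ : Representation k G V) : Prop :=
  ∀ (S : Subgroup G) (n : ℤ),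
    letI : Fintype S := Fintype.ofFinite S
    Subsingleton (tateCohomology (Rep.of (ρ.comp S.subtype)) n)

section Rank

variable {R : Type u} [CommRing R] (G : Type u) [Group G] (π : R)
  (A : Type u) [AddCommGroup A] [Module R A] [Module (MonoidAlgebra R G) A]

/-- The submodule `[A, G]` generated by the elements `g • a - a`. -/
def commutatorSubmodule (R : Type u) [CommRing R] (G : Type u) [Group G]
    (A : Type u) [AddCommGroup A] [Module R A] [Module (MonoidAlgebra R G) A] :
    Submodule R A :=
  Submodule.span R {x | ∃ (g : G) (a : A), x = MonoidAlgebra.of R G g • a - a}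

/-- The submodule `π A + [A, G]`. -/
def radicalSubmodule : Submodule R A :=
  Ideal.span {π} • (⊤ : Submodule R A) ⊔ commutatorSubmodule R G A

theorem isTorsionBySet_quotient_radicalSubmodule :
    Module.IsTorsionBySet R (A ⧸ radicalSubmodule G π A) (Ideal.span {π} : Ideal R) := by
  rintro x ⟨r, hr⟩
  obtain ⟨a, rfl⟩ := Submodule.Quotient.mk_surjective _ x
  rw [← Submodule.Quotient.mk_smul, Submodule.Quotient.mk_eq_zero]
  exact Submodule.mem_sup_left (Submodule.smul_mem_smul hr Submodule.mem_top)

/-- `r_R(A)`, the dimension of `A / (π A + [A, G])` over `R / (π)`. -/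
noncomputable def rankRG : ℕ :=
  letI : Module (R ⧸ (Ideal.span {π} : Ideal R)) (A ⧸ radicalSubmodule G π A) :=
    (isTorsionBySet_quotient_radicalSubmodule G π A).module
  Module.finrank (R ⧸ (Ideal.span {π} : Ideal R)) (A ⧸ radicalSubmodule G π A)

end Rank

/-! ### Tate cohomology vanishes when the identity is a norm -/

section

open CategoryTheory

/-! Let N be the sum of the elements of G. Free modules are cohomologically trivial
(`IsCohomologicallyTrivial.of_free`): the identity of RG is the sum of the G-conjugates of an
R-linear projection, and this gives a contracting homotopy of the Tate complex.

(i) ⇒ (ii): L and A are cohomologically trivial, hence so is M by the long exact sequence. For a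
cohomologically trivial lattice B, the vanishing of Ĥ⁻¹(G, B) means ker N = [B,G], so B/[B,G] ≅ NB
is free over the principal ideal domain R and r_R(B) is the R-rank of NB. As A is finite, M and L
have equal R-ranks, and so do the kernels of N on them; by rank-nullity the images have equal ranks
too (`rankRG_eq_of_exact_of_isCohomologicallyTrivial`).

(ii) ⇒ (i): take one presentation of A. Nakayama's lemma for p-groups
(`Submodule.eq_top_of_sup_radicalSubmodule`) shows that M is generated by as many elements as a
basis of L has, so L maps onto M. The R-ranks agree, so this map is an isomorphism
(`nonempty_linearEquiv_of_rankRG_eq`). Thus M is free, and the long exact sequence makes A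
cohomologically trivial. -/

theorem Fin.contractNth_succ_cons {α : Type*} (op : α → α → α) {n : ℕ} (j : Fin (n + 1)) (x : α)
    (g : Fin (n + 1) → α) :
    Fin.contractNth j.succ op (Fin.cons x g : Fin (n + 2) → α) =
      Fin.cons x (Fin.contractNth j op g) := by
  ext i
  refine Fin.cases ?_ (fun i => ?_) i
  · simp [Fin.contractNth]
  · simp only [Fin.contractNth, Fin.cons_succ, Fin.val_succ, ← Fin.succ_castSucc]
    simp

theorem Fin.contractNth_zero_cons {α : Type*} (op : α → α → α) {n : ℕ} (x : α)
    (g : Fin (n + 1) → α) :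
    Fin.contractNth 0 op (Fin.cons x g : Fin (n + 2) → α) =
      Fin.cons (op x (g 0)) (fun i => g i.succ) := by
  ext i
  refine Fin.cases ?_ (fun i => ?_) i
  · simp [Fin.contractNth]
  · simp [Fin.contractNth]

namespace Rep

variable {k G : Type u} [CommRing k] [Group G] [Fintype G] {A : Rep.{u} k G}

/-- The primitive of a cocycle f is g ↦ ∑ x h(f(x⁻¹, g)), summed over x. It works by the cocycle
identity at (x⁻¹, g) and the substitution x ↦ g₀x. -/
theorem exists_inhomogeneousCochains_d_eq (h : A →ₗ[k] A)
    (hh : ∀ v, ∑ g, A.ρ g (h (A.ρ g⁻¹ v)) = v) (n : ℕ) (f : (Fin (n + 1) → G) → A)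
    (hf : inhomogeneousCochains.d A (n + 1) f = 0) :
    ∃ e : (Fin n → G) → A, inhomogeneousCochains.d A n e = f := by
  refine ⟨fun g => ∑ x, A.ρ x (h (f (Fin.cons x⁻¹ g))), ?_⟩
  funext g
  have key : ∀ x : G, A.ρ x⁻¹ (f g) - f (Fin.cons (x⁻¹ * g 0) (fun i => g i.succ))
      - ∑ j : Fin (n + 1), (-1 : k) ^ ((j : ℕ) + 1) •
        f (Fin.cons x⁻¹ (Fin.contractNth j (· * ·) g)) = 0 := by
    intro x
    have := congrFun hf (Fin.cons x⁻¹ g)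
    simp only [inhomogeneousCochains.d_hom_apply, Fin.cons_zero, Fin.cons_succ] at this
    rw [Fin.sum_univ_succ] at this
    simp only [Fin.contractNth_zero_cons, Fin.contractNth_succ_cons, Fin.val_succ, Fin.val_zero,
      pow_succ (-1 : k) (_ + 1), mul_neg, mul_one, neg_smul, Finset.sum_neg_distrib, zero_add,
      pow_one, one_smul] at this
    rw [sub_sub, sub_eq_add_neg, neg_add]
    exact this
  have := hh (f g)
  rw [inhomogeneousCochains.d_hom_apply]
  rw [← this]
  have e : ∀ x, A.ρ x⁻¹ (f g) = f (Fin.cons (x⁻¹ * g 0) (fun i => g i.succ))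
      + ∑ j : Fin (n + 1), (-1 : k) ^ ((j : ℕ) + 1) •
        f (Fin.cons x⁻¹ (Fin.contractNth j (· * ·) g)) := fun x => by
    rw [← sub_eq_zero, ← key x]; abel
  simp only [e, map_add, map_sum, map_smul, Finset.sum_add_distrib]
  congr 1
  · refine ((Equiv.sum_comp (Equiv.mulLeft (g 0)) _).symm.trans
      (Finset.sum_congr rfl fun x _ => ?_)).symm
    simp
  · rw [Finset.sum_comm]
    simp only [Finset.smul_sum]

theorem exists_inhomogeneousChains_d_eq (h : A →ₗ[k] A)
    (hh : ∀ v, ∑ g, A.ρ g (h (A.ρ g⁻¹ v)) = v) (n : ℕ) (f : (Fin (n + 1) → G) →₀ A)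
    (hf : groupHomology.inhomogeneousChains.d A n f = 0) :
    ∃ e : (Fin (n + 2) → G) →₀ A, groupHomology.inhomogeneousChains.d A (n + 1) e = f := by
  -- The homotopy sends g ⊗ a to the sum of (x, g) ⊗ h(xa). In ds + sd, the face dropping x
  -- contributes a by `hh`, and the other terms cancel.
  let s : ∀ m : ℕ, ((Fin m → G) →₀ A) →ₗ[k] ((Fin (m + 1) → G) →₀ A) := fun m =>
    Finsupp.lsum (R := k) k fun g => ∑ x : G, Finsupp.lsingle (Fin.cons x g) ∘ₗ h ∘ₗ A.ρ x
  have hs : ∀ m g a, s m (Finsupp.single g a) =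
      ∑ x : G, Finsupp.single (Fin.cons x g) (h (A.ρ x a)) := by
    intro m g a
    simp [s]
  have key : (groupHomology.inhomogeneousChains.d A (n + 1)).hom ∘ₗ s (n + 1) +
      s n ∘ₗ (groupHomology.inhomogeneousChains.d A n).hom = LinearMap.id := by
    refine Finsupp.lhom_ext fun g a => ?_
    have h2 : ∑ x : G, A.ρ x⁻¹ (h (A.ρ x a)) = a := by
      rw [← Equiv.sum_comp (Equiv.inv G)]
      simpa using hh a
    have hd : ∀ m (g : Fin (m + 1) → G) (a : A),
        (groupHomology.inhomogeneousChains.d A m).hom (Finsupp.single g a) = _ :=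
      fun m g a => groupHomology.inhomogeneousChains.d_single m g a
    rw [LinearMap.add_apply, LinearMap.comp_apply, LinearMap.comp_apply, hs, hd, map_sum]
    simp only [hd, map_add, map_sum, map_smul, hs, LinearMap.id_apply, Fin.cons_zero, Fin.cons_succ]
    simp only [Fin.sum_univ_succ (n := n + 1), Fin.contractNth_zero_cons,
      Fin.contractNth_succ_cons, Fin.val_succ, Fin.val_zero,
      pow_succ (-1 : k) (_ + 1), mul_neg, mul_one, neg_smul, Finset.sum_neg_distrib, zero_add,
      pow_one, one_smul, Finset.sum_add_distrib]
    rw [← Finsupp.single_finsetSum, h2, Finset.sum_comm]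
    have h3 : ∑ x : G, Finsupp.single (Fin.cons x fun i => g i.succ : Fin (n + 1) → G)
          (h (A.ρ x (A.ρ (g 0)⁻¹ a))) =
        ∑ x : G, Finsupp.single (Fin.cons (x * g 0) fun i => g i.succ : Fin (n + 1) → G)
          (h (A.ρ x a)) := by
      refine (Equiv.sum_comp (Equiv.mulRight (g 0)) _).symm.trans
        (Finset.sum_congr rfl fun x _ => ?_)
      simp
    rw [h3]
    simp only [Finset.smul_sum]
    abel
  refine ⟨s (n + 1) f, ?_⟩
  have := LinearMap.congr_fun key f
  simpa [hf] using this

theorem _root_.CochainComplex.exactAt_iff_forall_exists {R : Type u} [Ring R]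
    (C : CochainComplex (ModuleCat.{u} R) ℤ) (i j l : ℤ) (hij : i + 1 = j) (hjl : j + 1 = l) :
    C.ExactAt j ↔ ∀ x : C.X j, C.d j l x = 0 → ∃ y : C.X i, C.d i j y = x := by
  rw [HomologicalComplex.exactAt_iff' C i j l (by simp [← hij]) (by simp [← hjl]),
    ShortComplex.moduleCat_exact_iff]
  rfl

theorem tateComplex_d_zero_apply (f : (Fin 0 → G) → A) :
    (tateComplex A).d 0 1 f = inhomogeneousCochains.d A 0 f := by
  change (groupCohomology.inhomogeneousCochains A).d 0 1 f = _
  rw [groupCohomology.inhomogeneousCochains.d_def]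

theorem tateComplex_d_neg_one_apply (f : (Fin 0 → G) →₀ A) :
    (tateComplex A).d (-1) 0 f = fun _ => ∑ g : G, A.ρ g (f default) := by
  change tateNorm A f = _
  rw [tateNorm_eq]
  induction f using Finsupp.induction_linear with
  | zero => simp; rfl
  | add f g hf hg => rw [map_add, hf, hg]; funext _; simp [Finset.sum_add_distrib]
  | single g a =>
    funext _
    simp [Representation.norm, Unique.eq_default (α := Fin 0 → G)]

/-- Vanishing of `Ĥ⁻¹`, in terms of elements. -/
theorem subsingleton_tateCohomology_neg_one_iff :
    Subsingleton (tateCohomology A (-1)) ↔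
      ∀ a : A, ∑ g : G, A.ρ g a = 0 → a ∈ Representation.Coinvariants.ker A.ρ := by
  rw [← ModuleCat.isZero_iff_subsingleton]
  change Limits.IsZero ((tateComplex A).homology (-1)) ↔ _
  rw [← HomologicalComplex.exactAt_iff_isZero_homology,
    CochainComplex.exactAt_iff_forall_exists _ (-2) (-1) 0 (by simp) (by simp),
    ← groupHomology.range_d₁₀_eq_coinvariantsKer]
  have h₀ : ∀ f : (Fin 0 → G) →₀ A, (groupHomology.chainsIso₀ A).hom f = f default := by
    intro f
    simp [groupHomology.chainsIso₀]
  have hc : ∀ y : (Fin 1 → G) →₀ A, (show (Fin 0 → G) →₀ A from (tateComplex A).d (-2) (-1) y) default =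
      groupHomology.d₁₀ A ((groupHomology.chainsIso₁ A).hom y) := by
    intro y
    have := ConcreteCategory.congr_hom (groupHomology.comp_d₁₀_eq A) y
    rw [ConcreteCategory.comp_apply, ConcreteCategory.comp_apply] at this
    rw [this, ← h₀]
    rfl
  constructor
  · intro H a ha
    obtain ⟨y, hy⟩ := H (Finsupp.single default a : (Fin 0 → G) →₀ A)
      ((tateComplex_d_neg_one_apply _).trans (by simp only [Finsupp.single_eq_same, ha]; rfl))
    refine ⟨(groupHomology.chainsIso₁ A).hom y, (hc y).symm.trans ?_⟩
    rw [hy]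
    simp
  · intro H (f : (Fin 0 → G) →₀ A) hf
    rw [tateComplex_d_neg_one_apply] at hf
    obtain ⟨z, hz⟩ := H (f default) (congrFun hf default)
    refine ⟨(groupHomology.chainsIso₁ A).inv z, ?_⟩
    have := hc ((groupHomology.chainsIso₁ A).inv z)
    rw [Iso.inv_hom_id_apply] at this
    refine Finsupp.ext (fun x => ?_)
    rw [Unique.eq_default x]
    exact this.trans hz

/-- If the identity of a representation is the norm of a linear endomorphism, then its Tate
cohomology vanishes. -/
theorem subsingleton_tateCohomology_of_sum_conj (h : A →ₗ[k] A)
    (hh : ∀ v, ∑ g, A.ρ g (h (A.ρ g⁻¹ v)) = v) (n : ℤ) :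
    Subsingleton (tateCohomology A n) := by
  apply ModuleCat.subsingleton_of_isZero
  change Limits.IsZero ((tateComplex A).homology n)
  rw [← HomologicalComplex.exactAt_iff_isZero_homology]
  obtain (_ | n) | (_ | n) := n
  · refine (CochainComplex.exactAt_iff_forall_exists _ (-1) 0 1 (by simp) (by simp)).2 ?_
    intro (f : (Fin 0 → G) → A) hf
    -- An invariant a satisfies a = ∑ g h(g⁻¹a) = N(h(a)).
    refine ⟨Finsupp.single default (h (f default)), ?_⟩
    rw [tateComplex_d_zero_apply] at hf
    rw [tateComplex_d_neg_one_apply]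
    have hinv : ∀ g, A.ρ g (f default) = f default := by
      intro g
      have : _ = (0 : A) := congrFun hf (fun _ => g)
      rw [inhomogeneousCochains.d_hom_apply] at this
      simpa [Unique.eq_default (α := Fin 0 → G), ← sub_eq_add_neg, sub_eq_zero] using this
    funext x
    have := hh (f default)
    simp only [hinv] at this
    simpa [Unique.eq_default x] using this
  · refine (CochainComplex.exactAt_iff_forall_exists _ n (n + 1 : ℕ) (n + 2 : ℕ) rfl rfl).2 ?_
    intro (f : (Fin (n + 1) → G) → A) hf
    change (groupCohomology.inhomogeneousCochains A).d (n + 1) (n + 2) f = 0 at hf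
    rw [groupCohomology.inhomogeneousCochains.d_def] at hf
    obtain ⟨e, he⟩ := exists_inhomogeneousCochains_d_eq h hh n f hf
    refine ⟨e, ?_⟩
    change (groupCohomology.inhomogeneousCochains A).d n (n + 1) e = f
    rw [groupCohomology.inhomogeneousCochains.d_def]
    exact he
  · rw [HomologicalComplex.exactAt_iff_isZero_homology]
    refine ModuleCat.isZero_iff_subsingleton.2 (subsingleton_tateCohomology_neg_one_iff.2 ?_)
    intro a ha
    -- If Na = 0, subtracting this zero sum writes a as the sum of the elements g y - y with y =
    -- h(g⁻¹a).
    have h0 : ∑ g, h (A.ρ g⁻¹ a) = 0 := by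
      rw [← map_sum]
      exact (congrArg h ((Equiv.sum_comp (Equiv.inv G) (fun g => A.ρ g a)).trans ha)).trans
        (map_zero h)
    rw [← sub_zero a, ← h0]
    nth_rw 1 [← hh a]
    rw [← Finset.sum_sub_distrib]
    exact Submodule.sum_mem _ fun g _ => Representation.Coinvariants.sub_mem_ker g _
  · refine (CochainComplex.exactAt_iff_forall_exists _ (.negSucc (n + 2)) (.negSucc (n + 1))
      (.negSucc n) rfl rfl).2 ?_
    intro (f : (Fin (n + 1) → G) →₀ A) hf
    change (groupHomology.inhomogeneousChains A).d (n + 1) n f = 0 at hf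
    rw [groupHomology.inhomogeneousChains.d_def] at hf
    obtain ⟨e, he⟩ := exists_inhomogeneousChains_d_eq h hh n f hf
    refine ⟨e, ?_⟩
    change (groupHomology.inhomogeneousChains A).d (n + 2) (n + 1) e = f
    rw [groupHomology.inhomogeneousChains.d_def]
    exact he

end Rep

end

/-! ### Cohomologically trivial modules over a group ring -/

section

open CategoryTheory

variable {R : Type u} [CommRing R] {G : Type u} [Group G]
  {M L A : Type u}
  [AddCommGroup M] [Module R M] [Module (MonoidAlgebra R G) M] [IsScalarTower R (MonoidAlgebra R G) M]
  [AddCommGroup L] [Module R L] [Module (MonoidAlgebra R G) L] [IsScalarTower R (MonoidAlgebra R G) L]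
  [AddCommGroup A] [Module R A] [Module (MonoidAlgebra R G) A] [IsScalarTower R (MonoidAlgebra R G) A]

theorem Representation.ofModule'_apply (g : G) (x : M) :
    Representation.ofModule' (k := R) (G := G) M g x = MonoidAlgebra.of R G g • x := by
  simp [Representation.ofModule']

/-- The restriction of an `RG`-module to a subgroup, as an object of `Rep`. -/
noncomputable abbrev Rep.restrictModule (R : Type u) [CommRing R] {G : Type u} [Group G]
    (S : Subgroup G) (M : Type u)
    [AddCommGroup M] [Module R M] [Module (MonoidAlgebra R G) M]
    [IsScalarTower R (MonoidAlgebra R G) M] : Rep.{u} R S :=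
  Rep.of ((Representation.ofModule' (k := R) (G := G) M).comp S.subtype)

/-- An `RG`-linear map, restricted to a subgroup. -/
noncomputable def Rep.restrictMap (S : Subgroup G) (f : M →ₗ[MonoidAlgebra R G] L) :
    Rep.restrictModule R S M ⟶ Rep.restrictModule R S L :=
  Rep.ofHom (LinearMap.intertwiningMap_of_isIntertwiningMap _ _ (f.restrictScalars R) (by
    intro g v
    simp [Representation.ofModule'_apply]))

theorem Rep.shortExact_restrictMap (S : Subgroup G) (i : M →ₗ[MonoidAlgebra R G] L)
    (q : L →ₗ[MonoidAlgebra R G] A) (hi : Function.Injective i) (hiq : Function.Exact i q)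
    (hq : Function.Surjective q) :
    ∃ w, (ShortComplex.mk (Rep.restrictMap S i) (Rep.restrictMap S q) w).ShortExact := by
  refine ⟨?_, ?_⟩
  · ext x
    exact hiq.apply_apply_eq_zero x
  · refine { exact := ?_, mono_f := (Rep.mono_iff_injective _).2 hi,
             epi_g := (Rep.epi_iff_surjective _).2 hq }
    rw [← ShortComplex.exact_map_iff_of_faithful _ (forget₂ (Rep.{u} R S) (ModuleCat.{u} R)),
      ShortComplex.moduleCat_exact_iff]
    intro x hx
    exact (hiq x).1 hx

variable [Finite G]

theorem IsCohomologicallyTrivial.of_exact_left (i : M →ₗ[MonoidAlgebra R G] L)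
    (q : L →ₗ[MonoidAlgebra R G] A) (hi : Function.Injective i) (hiq : Function.Exact i q)
    (hq : Function.Surjective q)
    (hL : IsCohomologicallyTrivial (Representation.ofModule' (k := R) (G := G) L))
    (hA : IsCohomologicallyTrivial (Representation.ofModule' (k := R) (G := G) A)) :
    IsCohomologicallyTrivial (Representation.ofModule' (k := R) (G := G) M) := by
  intro S n
  let _ : Fintype S := Fintype.ofFinite S
  obtain ⟨w, h⟩ := Rep.shortExact_restrictMap S i q hi hiq hq
  -- The connecting map into the cohomology of M starts one degree lower.
  obtain ⟨n, rfl⟩ : ∃ m, n = m + 1 := ⟨n - 1, by ring⟩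
  refine ModuleCat.subsingleton_of_isZero ?_
  exact (TateCohomology.exact₁ h n).isZero_of_both_zeros
    ((ModuleCat.isZero_iff_subsingleton.2 (hA S n)).eq_of_src _ _)
    ((ModuleCat.isZero_iff_subsingleton.2 (hL S (n + 1))).eq_of_tgt _ _)

theorem IsCohomologicallyTrivial.of_exact_right (i : M →ₗ[MonoidAlgebra R G] L)
    (q : L →ₗ[MonoidAlgebra R G] A) (hi : Function.Injective i) (hiq : Function.Exact i q)
    (hq : Function.Surjective q)
    (hM : IsCohomologicallyTrivial (Representation.ofModule' (k := R) (G := G) M))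
    (hL : IsCohomologicallyTrivial (Representation.ofModule' (k := R) (G := G) L)) :
    IsCohomologicallyTrivial (Representation.ofModule' (k := R) (G := G) A) := by
  intro S n
  let _ : Fintype S := Fintype.ofFinite S
  obtain ⟨w, h⟩ := Rep.shortExact_restrictMap S i q hi hiq hq
  refine ModuleCat.subsingleton_of_isZero ?_
  exact (TateCohomology.exact₃ h n).isZero_of_both_zeros
    ((ModuleCat.isZero_iff_subsingleton.2 (hL S n)).eq_of_src _ _)
    ((ModuleCat.isZero_iff_subsingleton.2 (hM S (n + 1))).eq_of_tgt _ _)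

/-- If the identity is the norm of an `R`-linear endomorphism for the group `G`, then the module is
cohomologically trivial. -/
theorem IsCohomologicallyTrivial.of_sum_conj [Fintype G] (h : M →ₗ[R] M)
    (hh : ∀ v, ∑ g : G, MonoidAlgebra.of R G g • h (MonoidAlgebra.of R G g⁻¹ • v) = v) :
    IsCohomologicallyTrivial (Representation.ofModule' (k := R) (G := G) M) := by
  classical
  intro S n
  let _ : Fintype S := Fintype.ofFinite S
  let _ : Fintype (G ⧸ S) := Fintype.ofFinite _
  let ρ := Representation.ofModule' (k := R) (G := G) M
  -- For G the disjoint union of the cosets tS, the S-norm of ∑ t⁻¹ h t is the G-norm of h, since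
  -- every g is uniquely ts.
  refine Rep.subsingleton_tateCohomology_of_sum_conj
    (∑ t : G ⧸ S, ρ (t.out)⁻¹ ∘ₗ h ∘ₗ ρ t.out) (fun v => ?_) n
  have hv : ∑ g : G, ρ g⁻¹ (h (ρ g v)) = v := by
    refine (Equiv.sum_comp (Equiv.inv G) _).symm.trans (Eq.trans ?_ (hh v))
    simp [ρ, Representation.ofModule'_apply]
  conv_rhs => rw [← hv]
  have hbij : Function.Bijective fun x : (G ⧸ S) × S => x.1.out * (x.2 : G) := by
    constructor
    · rintro ⟨t, s⟩ ⟨t', s'⟩ hts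
      have ht : t = t' := by
        have := congrArg (QuotientGroup.mk (s := S)) hts
        simpa using this
      subst ht
      simpa using hts
    · intro g
      have hg : (QuotientGroup.mk g : G ⧸ S).out⁻¹ * g ∈ S :=
        QuotientGroup.eq.1 (Quotient.out_eq _)
      exact ⟨⟨QuotientGroup.mk g, _, hg⟩, by simp⟩
  rw [← Equiv.sum_comp (Equiv.ofBijective _ hbij), Fintype.sum_prod_type_right]
  refine (Equiv.sum_comp (Equiv.inv S) _).symm.trans (Finset.sum_congr rfl fun s _ => ?_)
  rw [LinearMap.sum_apply, map_sum]
  refine Finset.sum_congr rfl fun t _ => ?_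
  simp [ρ]

omit [Finite G] in
-- This exhibits the identity of RG as the norm of the projection onto the coefficient of 1, as
-- `IsCohomologicallyTrivial.of_sum_conj` requires.
theorem MonoidAlgebra.sum_of_mul_single_coeff_one [Fintype G] (x : MonoidAlgebra R G) :
    ∑ g : G, MonoidAlgebra.of R G g *
      MonoidAlgebra.single 1 ((MonoidAlgebra.of R G g⁻¹ * x).coeff 1) = x := by
  classical
  ext g
  simp [MonoidAlgebra.coeff_sum, MonoidAlgebra.single_mul_single,
    MonoidAlgebra.coeff_single_mul_apply]

/-- A free `RG`-module is cohomologically trivial. -/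
theorem IsCohomologicallyTrivial.of_free [Module.Free (MonoidAlgebra R G) L] :
    IsCohomologicallyTrivial (Representation.ofModule' (k := R) (G := G) L) := by
  classical
  let _ : Fintype G := Fintype.ofFinite G
  let b := Module.Free.chooseBasis (MonoidAlgebra R G) L
  let e : L ≃ₗ[R] (_ →₀ MonoidAlgebra R G) := b.repr.restrictScalars R
  let c : MonoidAlgebra R G →ₗ[R] MonoidAlgebra R G :=
    { toFun x := MonoidAlgebra.single 1 (x.coeff 1)
      map_add' x y := by simp
      map_smul' r x := by simp }
  refine .of_sum_conj (e.symm.toLinearMap ∘ₗ Finsupp.mapRange.linearMap c ∘ₗ e.toLinearMap)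
    fun v => b.repr.injective (Finsupp.ext fun j => ?_)
  conv_rhs => rw [← MonoidAlgebra.sum_of_mul_single_coeff_one (b.repr v j)]
  have : ∀ y, b.repr (e.symm y) = y := fun y => b.repr.apply_symm_apply y
  simp only [LinearMap.comp_apply, LinearEquiv.coe_coe, map_sum, map_smul, this,
    Finsupp.finsetSum_apply, Finsupp.smul_apply, smul_eq_mul, Finsupp.mapRange.linearMap_apply,
    Finsupp.mapRange_apply]
  refine Finset.sum_congr rfl fun g _ => ?_
  change _ * MonoidAlgebra.single 1 ((b.repr (MonoidAlgebra.of R G g⁻¹ • v) j).coeff 1) = _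
  rw [map_smul, Finsupp.smul_apply, smul_eq_mul]

/-- Only Ĥ⁻¹ of the whole group, that is ker N modulo [M,G], is used. -/
theorem IsCohomologicallyTrivial.mem_commutatorSubmodule [Fintype G]
    (hM : IsCohomologicallyTrivial (Representation.ofModule' (k := R) (G := G) M)) (x : M)
    (hx : ∑ g : G, MonoidAlgebra.of R G g • x = 0) : x ∈ commutatorSubmodule R G M := by
  let _ : Fintype (⊤ : Subgroup G) := Fintype.ofFinite _
  have := Rep.subsingleton_tateCohomology_neg_one_iff.1 (hM ⊤ (-1)) x ?_
  · refine Submodule.span_le.2 ?_ this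
    rintro _ ⟨⟨g, a⟩, rfl⟩
    exact Submodule.subset_span ⟨g.1, a, rfl⟩
  · rw [← hx]
    refine (Equiv.sum_comp Subgroup.topEquiv.toEquiv _).symm.trans
      (Finset.sum_congr rfl fun g _ => ?_) |>.symm
    simp [Representation.ofModule'_apply]

end

/-! ### The ring of integers of a finite extension of ℚ_p -/

section

variable (p : ℕ) [Fact p.Prime] {K : Type*} [Field K] [Algebra ℚ_[p] K] [FiniteDimensional ℚ_[p] K]
    [Algebra ℤ_[p] K] [IsScalarTower ℤ_[p] ℚ_[p] K]

/-- The spectral norm is at most 1 exactly when the minimal polynomial over ℚ_p has coefficients in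
ℤ_p; as ℤ_p is integrally closed, this is integrality. -/
theorem PadicInt.isIntegral_iff_spectralNorm_le_one (x : K) :
    IsIntegral ℤ_[p] x ↔ spectralNorm ℚ_[p] K x ≤ 1 := by
  have hx : IsIntegral ℚ_[p] x := Algebra.IsIntegral.isIntegral x
  rw [spectralNorm, spectralValue_le_one_iff (minpoly.monic hx)]
  constructor
  · intro h n
    rw [minpoly.isIntegrallyClosed_eq_field_fractions' ℚ_[p] h, Polynomial.coeff_map]
    exact PadicInt.norm_le_one _
  · intro h
    obtain ⟨q, hq, -, hm⟩ := Polynomial.lifts_and_natDegree_eq_and_monic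
      ((Polynomial.lifts_iff_coeff_lifts (f := algebraMap ℤ_[p] ℚ_[p]) (minpoly ℚ_[p] x)).2
        fun n => ⟨⟨_, h n⟩, rfl⟩) (minpoly.monic hx)
    refine ⟨q, hm, ?_⟩
    have := minpoly.aeval ℚ_[p] x
    rw [← hq, Polynomial.aeval_map_algebraMap] at this
    exact this

variable (K) (R : Type u) [CommRing R] [Algebra ℤ_[p] R] [Algebra R K] [IsScalarTower ℤ_[p] R K]
    [IsIntegralClosure R ℤ_[p] K]

include p K

omit [Algebra ℤ_[p] R] [IsScalarTower ℤ_[p] R K] in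
-- An element of spectral norm at least 1 has an integral inverse, and the ultrametric inequality
-- forces one of a, b to be such an element when a + b = 1.
theorem PadicInt.isLocalRing_of_isIntegralClosure : IsLocalRing R := by
  have hinj : Function.Injective (algebraMap R K) := IsIntegralClosure.algebraMap_injective R ℤ_[p] K
  have : Nontrivial R := (algebraMap R K).domain_nontrivial
  have key : ∀ a : R, 1 ≤ spectralNorm ℚ_[p] K (algebraMap R K a) → IsUnit a := by
    intro a ha
    have h0 : algebraMap R K a ≠ 0 := by
      intro h
      rw [h, spectralNorm_zero] at ha
      norm_num at ha
    have h1 : spectralNorm ℚ_[p] K (algebraMap R K a)⁻¹ ≤ 1 := by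
      have := map_inv₀ (spectralMulAlgNorm ℚ_[p] K) (algebraMap R K a)
      simp only [spectralMulAlgNorm_def] at this
      rw [this]
      exact inv_le_one_of_one_le₀ ha
    obtain ⟨b, hb⟩ := IsIntegralClosure.isIntegral_iff (A := R).1
      ((PadicInt.isIntegral_iff_spectralNorm_le_one p _).2 h1)
    refine IsUnit.of_mul_eq_one b (hinj ?_)
    rw [map_mul, hb, map_one, mul_inv_cancel₀ h0]
  refine ⟨fun {a b} hab => ?_⟩
  have h := isNonarchimedean_spectralNorm (K := ℚ_[p]) (L := K) (algebraMap R K a) (algebraMap R K b)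
  rw [← map_add, hab, map_one, spectralNorm_one] at h
  exact (le_max_iff.1 h).imp (key a) (key b)

omit [Algebra ℚ_[p] K] [FiniteDimensional ℚ_[p] K] [IsScalarTower ℤ_[p] ℚ_[p] K]
  [Algebra ℤ_[p] R] [IsScalarTower ℤ_[p] R K] in
theorem PadicInt.isDomain_of_isIntegralClosure : IsDomain R :=
  (IsIntegralClosure.algebraMap_injective R ℤ_[p] K).isDomain (algebraMap R K)

theorem PadicInt.isPrincipalIdealRing_of_isIntegralClosure : IsPrincipalIdealRing R := by
  have := PadicInt.isDomain_of_isIntegralClosure p K R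
  have := PadicInt.isLocalRing_of_isIntegralClosure p K R
  have : IsDedekindDomain R := IsIntegralClosure.isDedekindDomain ℤ_[p] ℚ_[p] K R
  have h := (tfae_of_isNoetherianRing_of_isLocalRing_of_isDomain R).out 0 2
  exact h.2 ‹_›

variable {R}

theorem PadicInt.maximalIdeal_eq_span_of_irreducible [IsLocalRing R] {π : R}
    (hπ : Irreducible π) : IsLocalRing.maximalIdeal R = Ideal.span {π} := by
  have := PadicInt.isDomain_of_isIntegralClosure p K R
  have := PadicInt.isPrincipalIdealRing_of_isIntegralClosure p K R
  exact (IsLocalRing.eq_maximalIdeal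
    (PrincipalIdealRing.isMaximal_of_irreducible hπ)).symm

theorem PadicInt.natCast_mem_span_irreducible {π : R} (hπ : Irreducible π) :
    (p : R) ∈ Ideal.span {π} := by
  have := PadicInt.isDomain_of_isIntegralClosure p K R
  have := PadicInt.isLocalRing_of_isIntegralClosure p K R
  rw [← PadicInt.maximalIdeal_eq_span_of_irreducible p K hπ, IsLocalRing.mem_maximalIdeal,
    mem_nonunits_iff]
  have : Algebra.IsIntegral ℤ_[p] R := IsIntegralClosure.isIntegral_algebra ℤ_[p] K
  have : Module.IsTorsionFree ℤ_[p] K := .trans_faithfulSMul ℤ_[p] ℚ_[p] K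
  have : Module.IsTorsionFree ℤ_[p] R := IsIntegralClosure.isTorsionFree ℤ_[p] K
  -- R is integral over ℤ_p and contains it, so p could be a unit of R only by being one of ℤ_p.
  intro h
  rw [← map_natCast (algebraMap ℤ_[p] R)] at h
  exact PadicInt.prime_p.not_isUnit (isUnit_of_map_unit (algebraMap ℤ_[p] R) _ h)

/-- The quotient is finitely generated over ℤ_p and killed by p, hence a finite-dimensional space
over the residue field of ℤ_p. -/
theorem PadicInt.finite_quotient_span_irreducible {π : R} (hπ : Irreducible π) :
    Finite (R ⧸ Ideal.span {π}) := by
  have : Module.Finite ℤ_[p] R := IsIntegralClosure.finite ℤ_[p] ℚ_[p] K R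
  have hp := PadicInt.natCast_mem_span_irreducible p K hπ
  have ht : Module.IsTorsionBySet ℤ_[p] (R ⧸ Ideal.span {π})
      (IsLocalRing.maximalIdeal ℤ_[p] : Set ℤ_[p]) := by
    rw [PadicInt.maximalIdeal_eq_span_p]
    rintro x ⟨a, ha⟩
    obtain ⟨b, rfl⟩ := Ideal.mem_span_singleton.1 ha
    obtain ⟨y, rfl⟩ := Ideal.Quotient.mk_surjective x
    rw [Algebra.smul_def, IsScalarTower.algebraMap_apply ℤ_[p] R, Ideal.Quotient.algebraMap_eq,
      ← map_mul, Ideal.Quotient.eq_zero_iff_mem, map_mul, map_natCast]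
    exact Ideal.mul_mem_right _ _ (Ideal.mul_mem_right _ _ hp)
  let _ : Module (ℤ_[p] ⧸ IsLocalRing.maximalIdeal ℤ_[p]) (R ⧸ Ideal.span {π}) := ht.module
  have : IsScalarTower ℤ_[p] (ℤ_[p] ⧸ IsLocalRing.maximalIdeal ℤ_[p]) (R ⧸ Ideal.span {π}) :=
    ht.isScalarTower
  have : Finite (ℤ_[p] ⧸ IsLocalRing.maximalIdeal ℤ_[p]) :=
    Finite.of_equiv _ (PadicInt.residueField (p := p)).symm.toEquiv
  have : Module.Finite (ℤ_[p] ⧸ IsLocalRing.maximalIdeal ℤ_[p]) (R ⧸ Ideal.span {π}) :=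
    Module.Finite.of_restrictScalars_finite ℤ_[p] _ _
  exact Module.finite_of_finite (ℤ_[p] ⧸ IsLocalRing.maximalIdeal ℤ_[p])

end

/-! ### Nakayama's lemma for group rings of p-groups -/

section

variable {R : Type u} [CommRing R] {G : Type u} [Group G] (π : R)
  {M L : Type u}
  [AddCommGroup M] [Module R M] [Module (MonoidAlgebra R G) M] [IsScalarTower R (MonoidAlgebra R G) M]
  [AddCommGroup L] [Module R L] [Module (MonoidAlgebra R G) L] [IsScalarTower R (MonoidAlgebra R G) L]

/-- Over a `p`-group and a base ring with residue field of characteristic `p`, a finitely generated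
module `M` with `M = πM + [M, G]` vanishes. -/
theorem subsingleton_of_radicalSubmodule_eq_top (p : ℕ) [Fact p.Prime] [Finite G]
    (hG : IsPGroup p G) (hjac : Ideal.span {π} ≤ Ideal.jacobson ⊥) (hmax : (Ideal.span {π}).IsMaximal)
    [Finite (R ⧸ Ideal.span {π})] (hp : (p : R) ∈ Ideal.span {π}) [Module.Finite R M]
    (h : radicalSubmodule G π M = ⊤) : Subsingleton M := by
  by_contra hM
  rw [not_subsingleton_iff_nontrivial] at hM
  let k := R ⧸ Ideal.span {π}
  let _ : Field k := Ideal.Quotient.field _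
  -- the dual `X` of `M / πM` is a finite nonzero `G`-module of `p`-power torsion
  let X := M →ₗ[R] k
  have hX : Finite X := by
    obtain ⟨s, hs⟩ := Module.Finite.fg_top (R := R) (M := M)
    refine Finite.of_injective (fun (f : X) (x : s) => f x) fun f g hfg => ?_
    exact LinearMap.ext_on hs fun x hx => congrFun hfg ⟨x, hx⟩
  have hsmul : ∀ r ∈ Ideal.span {π}, ∀ y : k, r • y = 0 := by
    intro r hr y
    rw [Algebra.smul_def, Ideal.Quotient.algebraMap_eq, Ideal.Quotient.eq_zero_iff_mem.2 hr,
      zero_mul]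
  -- Functionals separate the points of M/πM, so X = 0 would give M = πM, and M = 0 by the ordinary
  -- Nakayama lemma.
  obtain ⟨f, hf⟩ : ∃ f : X, f ≠ 0 := by
    by_contra! hX0
    have htop : Ideal.span {π} • (⊤ : Submodule R M) = ⊤ := by
      rw [eq_top_iff]
      intro x _
      rw [← Submodule.Quotient.mk_eq_zero, ← Module.forall_dual_apply_eq_zero_iff k]
      intro φ
      exact LinearMap.congr_fun (hX0 (φ.restrictScalars R ∘ₗ Submodule.mkQ _)) x
    exact top_ne_bot (Submodule.eq_bot_of_le_smul_of_le_jacobson_bot _ _ Module.Finite.fg_top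
      htop.ge hjac)
  let ρ := Representation.ofModule' (k := R) (G := G) M
  let _ : MulAction G X :=
    { smul g f := f ∘ₗ ρ g⁻¹
      one_smul f := by
        change f ∘ₗ ρ 1⁻¹ = f
        simp [LinearMap.comp_id, Module.End.one_eq_id]
      mul_smul g g' f := by
        change f ∘ₗ ρ (g * g')⁻¹ = (f ∘ₗ ρ g'⁻¹) ∘ₗ ρ g⁻¹
        rw [mul_inv_rev, map_mul, LinearMap.comp_assoc]
        rfl }
  have hpX : ∀ f : X, p • f = 0 := by
    intro f
    ext x
    rw [LinearMap.smul_apply, ← Nat.cast_smul_eq_nsmul R, hsmul _ hp, LinearMap.zero_apply]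
  have hdvd : p ∣ Nat.card X := addOrderOf_eq_prime (hpX f) hf ▸ addOrderOf_dvd_natCard f
  -- Orbit counting gives a nonzero G-invariant f. It kills both πM and [M,G], hence all of M, a
  -- contradiction.
  obtain ⟨f, hf, hf0⟩ := hG.exists_fixed_point_of_prime_dvd_card_of_fixed_point X hdvd (a := 0) (by
    intro g
    change (0 : X) ∘ₗ ρ g⁻¹ = 0
    rw [LinearMap.zero_comp])
  refine hf0 ?_
  symm
  rw [← LinearMap.ker_eq_top, eq_top_iff, ← h]
  refine sup_le (Submodule.smul_le.2 ?_) (Submodule.span_le.2 ?_)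
  · intro r hr x _
    rw [LinearMap.mem_ker, map_smul, hsmul r hr]
  · rintro _ ⟨g, a, rfl⟩
    have := LinearMap.congr_fun (hf g⁻¹) a
    change f (ρ g⁻¹⁻¹ a) = f a at this
    rw [inv_inv, Representation.ofModule'_apply] at this
    rw [SetLike.mem_coe, LinearMap.mem_ker, map_sub, this, sub_self]

theorem map_radicalSubmodule_le (f : M →ₗ[MonoidAlgebra R G] L) :
    (radicalSubmodule G π M).map (f.restrictScalars R) ≤ radicalSubmodule G π L := by
  rw [radicalSubmodule, Submodule.map_sup, Submodule.map_smul'']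
  refine sup_le_sup (Submodule.smul_mono le_rfl le_top) ?_
  rw [commutatorSubmodule, Submodule.map_span]
  refine Submodule.span_mono ?_
  rintro _ ⟨_, ⟨g, a, rfl⟩, rfl⟩
  exact ⟨g, f a, by simp⟩

/-- Nakayama's lemma for group rings of `p`-groups. -/
theorem Submodule.eq_top_of_sup_radicalSubmodule (p : ℕ) [Fact p.Prime] [Finite G]
    (hG : IsPGroup p G) (hjac : Ideal.span {π} ≤ Ideal.jacobson ⊥) (hmax : (Ideal.span {π}).IsMaximal)
    [Finite (R ⧸ Ideal.span {π})] (hp : (p : R) ∈ Ideal.span {π}) [Module.Finite R M]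
    (W : Submodule (MonoidAlgebra R G) M)
    (h : W.restrictScalars R ⊔ radicalSubmodule G π M = ⊤) : W = ⊤ := by
  rw [← Submodule.Quotient.subsingleton_iff]
  have : Module.Finite R (M ⧸ W) := Module.Finite.of_surjective (W.mkQ.restrictScalars R) W.mkQ_surjective
  refine subsingleton_of_radicalSubmodule_eq_top π p hG hjac hmax hp ?_
  rw [eq_top_iff, ← LinearMap.range_eq_top.2 (show Function.Surjective (W.mkQ.restrictScalars R)
    from W.mkQ_surjective), LinearMap.range_eq_map, ← h, Submodule.map_sup]
  refine sup_le ?_ (map_radicalSubmodule_le π W.mkQ)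
  rintro _ ⟨x, hx, rfl⟩
  rw [LinearMap.restrictScalars_apply, Submodule.mkQ_apply, (Submodule.Quotient.mk_eq_zero W).2 hx]
  exact zero_mem _

end

/-! ### Comparison of generator numbers with R-ranks -/

section

/-- The image of q is killed by the order of A, which is nonzero in R, so it has rank zero.
Surjectivity of q is not required, which allows the application to kernels of norms. -/
theorem LinearMap.finrank_eq_of_exact_of_finite {R M L A : Type*} [CommRing R] [IsDomain R]
    [CharZero R] [AddCommGroup M] [Module R M] [AddCommGroup L] [Module R L] [AddCommGroup A]
    [Module R A] [Module.Finite R L] [Finite A] (i : M →ₗ[R] L) (q : L →ₗ[R] A)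
    (hi : Function.Injective i) (hiq : Function.Exact i q) :
    Module.finrank R M = Module.finrank R L := by
  have h := (LinearMap.ker q).finrank_quotient_add_finrank
  rw [q.quotKerEquivRange.finrank_eq] at h
  have h0 : Module.finrank R q.range = 0 := by
    refine Module.finrank_eq_zero_iff_isTorsion.2 fun x => ?_
    have : Nat.card A ≠ 0 := Nat.card_ne_zero.2 ⟨inferInstance, inferInstance⟩
    refine ⟨⟨(Nat.card A : R), mem_nonZeroDivisors_of_ne_zero (by exact_mod_cast this)⟩, ?_⟩
    refine Subtype.ext ?_
    change (Nat.card A : R) • (x : A) = 0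
    rw [Nat.cast_smul_eq_nsmul, card_nsmul_eq_zero']
  rw [hiq.linearMap_ker_eq, h0, zero_add, LinearMap.finrank_range_of_inj hi] at h
  exact h

theorem Module.Free.finrank_quotient_smul_top {R P : Type*} [CommRing R] [Nontrivial R] (I : Ideal R)
    [Nontrivial (R ⧸ I)] [AddCommGroup P] [Module R P] [Module.Free R P] [Module.Finite R P] :
    Module.finrank (R ⧸ I) (P ⧸ (I • ⊤ : Submodule R P)) = Module.finrank R P := by
  have e := (TensorProduct.quotTensorEquivQuotSMul P I).extendScalarsOfSurjective
    (S := R ⧸ I) Ideal.Quotient.mk_surjective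
  rw [← e.finrank_eq, Module.finrank_baseChange]

variable {R : Type u} [CommRing R] {G : Type u} [Group G] (π : R)
  {M L A : Type u}
  [AddCommGroup M] [Module R M] [Module (MonoidAlgebra R G) M] [IsScalarTower R (MonoidAlgebra R G) M]
  [AddCommGroup L] [Module R L] [Module (MonoidAlgebra R G) L] [IsScalarTower R (MonoidAlgebra R G) L]
  [AddCommGroup A] [Module R A] [Module (MonoidAlgebra R G) A] [IsScalarTower R (MonoidAlgebra R G) A]

/-- Multiplication by the norm element of the group ring. -/
noncomputable def normMap (R G M : Type u) [CommRing R] [Group G] [Fintype G] [AddCommGroup M]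
    [Module R M] [Module (MonoidAlgebra R G) M] [IsScalarTower R (MonoidAlgebra R G) M] :
    M →ₗ[R] M :=
  ∑ g : G, Module.toModuleEnd R (S := MonoidAlgebra R G) M (MonoidAlgebra.of R G g)

theorem normMap_apply [Fintype G] (x : M) :
    normMap R G M x = ∑ g : G, MonoidAlgebra.of R G g • x := by
  simp [normMap]

theorem commutatorSubmodule_le_ker_normMap [Fintype G] :
    commutatorSubmodule R G M ≤ LinearMap.ker (normMap R G M) := by
  refine Submodule.span_le.2 ?_
  rintro _ ⟨g, a, rfl⟩
  rw [SetLike.mem_coe, LinearMap.mem_ker, map_sub, sub_eq_zero, normMap_apply, normMap_apply]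
  refine Eq.trans ?_ (Equiv.sum_comp (Equiv.mulRight g) _)
  simp [smul_smul]

/-- If the kernel of the norm is `[M, G]`, the rank is that of the image of the norm. -/
theorem rankRG_eq_finrank_range_normMap [Fintype G] [IsDomain R] [IsPrincipalIdealRing R]
    [Nontrivial (R ⧸ Ideal.span {π})]
    [Module.Finite R M] [Module.IsTorsionFree R M]
    (h : LinearMap.ker (normMap R G M) ≤ commutatorSubmodule R G M) :
    rankRG G π M = Module.finrank R (LinearMap.range (normMap R G M)) := by
  let I := Ideal.span {π}
  let P := LinearMap.range (normMap R G M)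
  rw [← Module.Free.finrank_quotient_smul_top I (P := P)]
  let ht := isTorsionBySet_quotient_radicalSubmodule G π M
  let _ : Module (R ⧸ I) (M ⧸ radicalSubmodule G π M) := ht.module
  have : IsScalarTower R (R ⧸ I) (M ⧸ radicalSubmodule G π M) := ht.isScalarTower
  -- The norm identifies M/[M,G] with P, hence M/(πM + [M,G]) with P/πP, whose dimension is the rank
  -- of the free module P.
  let f : M →ₗ[R] P ⧸ (I • ⊤ : Submodule R P) := Submodule.mkQ _ ∘ₗ (normMap R G M).rangeRestrict
  have hf : Function.Surjective f :=
    (Submodule.mkQ_surjective _).comp (LinearMap.surjective_rangeRestrict _)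
  have hker : LinearMap.ker f = radicalSubmodule G π M := by
    have hr : (I • ⊤ : Submodule R P) = (I • ⊤ : Submodule R M).map (normMap R G M).rangeRestrict := by
      rw [Submodule.map_smul'', ← LinearMap.range_eq_map, LinearMap.range_rangeRestrict]
    rw [LinearMap.ker_comp, Submodule.ker_mkQ, hr, Submodule.comap_map_eq,
      LinearMap.ker_rangeRestrict, h.antisymm commutatorSubmodule_le_ker_normMap]
    rfl
  let e := (Submodule.quotEquivOfEq _ _ hker.symm).trans (f.quotKerEquivOfSurjective hf)
  exact (e.extendScalarsOfSurjective (S := R ⧸ I) Ideal.Quotient.mk_surjective).finrank_eq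

/-- Group elements act trivially modulo [L,G], so RG-generators become R-generators there. -/
theorem span_range_basis_sup_commutatorSubmodule {ι : Type*}
    (b : Module.Basis ι (MonoidAlgebra R G) L) :
    Submodule.span R (Set.range b) ⊔ commutatorSubmodule R G L = ⊤ := by
  rw [eq_top_iff]
  intro x _
  have hx := b.mem_span x
  induction hx using Submodule.span_induction with
  | mem x hx => exact Submodule.mem_sup_left (Submodule.subset_span hx)
  | zero => exact zero_mem _
  | add x y _ _ hx hy => exact add_mem (hx trivial) (hy trivial)
  | smul a x _ hx =>
    have hx := hx trivial
    induction a using MonoidAlgebra.induction_on with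
    | of g =>
      rw [← sub_add_cancel (MonoidAlgebra.of R G g • x) x]
      exact add_mem (Submodule.mem_sup_right (Submodule.subset_span ⟨g, x, rfl⟩)) hx
    | add a b ha hb => rw [add_smul]; exact add_mem (ha trivial) (hb trivial)
    | smul r a ha => rw [smul_assoc]; exact Submodule.smul_mem _ _ (ha trivial)

omit [Module (MonoidAlgebra R G) L] [IsScalarTower R (MonoidAlgebra R G) L] in
theorem span_range_sup_eq_top_iff {ι : Type*} (I : Ideal R) (N : Submodule R L)
    [Module (R ⧸ I) (L ⧸ N)] [IsScalarTower R (R ⧸ I) (L ⧸ N)] (v : ι → L) :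
    Submodule.span R (Set.range v) ⊔ N = ⊤ ↔
      Submodule.span (R ⧸ I) (Set.range fun j => (Submodule.Quotient.mk (v j) : L ⧸ N)) = ⊤ := by
  rw [sup_comm, ← Submodule.map_mkQ_eq_top, Submodule.map_span, ← Set.range_comp,
    ← Submodule.restrictScalars_eq_top_iff R (R ⧸ I),
    Submodule.restrictScalars_span R (R ⧸ I) Ideal.Quotient.mk_surjective]
  rfl

omit [IsScalarTower R (MonoidAlgebra R G) L] in
theorem rankRG_le_card {ι : Type*} [Fintype ι] [Nontrivial (R ⧸ Ideal.span {π})] (v : ι → L)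
    (hv : Submodule.span R (Set.range v) ⊔ radicalSubmodule G π L = ⊤) :
    rankRG G π L ≤ Fintype.card ι := by
  let I := Ideal.span {π}
  let ht := isTorsionBySet_quotient_radicalSubmodule G π L
  let _ : Module (R ⧸ I) (L ⧸ radicalSubmodule G π L) := ht.module
  have : IsScalarTower R (R ⧸ I) (L ⧸ radicalSubmodule G π L) := ht.isScalarTower
  rw [span_range_sup_eq_top_iff I] at hv
  have := finrank_range_le_card (R := R ⧸ I)
    (fun j => (Submodule.Quotient.mk (v j) : L ⧸ radicalSubmodule G π L))
  rw [Set.finrank, hv, finrank_top] at this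
  exact this

omit [IsScalarTower R (MonoidAlgebra R G) M] in
theorem exists_span_sup_radicalSubmodule {ι : Type*} [Fintype ι] (hmax : (Ideal.span {π}).IsMaximal)
    [Module.Finite R M] (h : rankRG G π M ≤ Fintype.card ι) :
    ∃ v : ι → M, Submodule.span R (Set.range v) ⊔ radicalSubmodule G π M = ⊤ := by
  let I := Ideal.span {π}
  let ht := isTorsionBySet_quotient_radicalSubmodule G π M
  let _ : Module (R ⧸ I) (M ⧸ radicalSubmodule G π M) := ht.module
  have : IsScalarTower R (R ⧸ I) (M ⧸ radicalSubmodule G π M) := ht.isScalarTower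
  let _ : Field (R ⧸ I) := Ideal.Quotient.field _
  have : Module.Finite (R ⧸ I) (M ⧸ radicalSubmodule G π M) :=
    Module.Finite.of_restrictScalars_finite R _ _
  let b := Module.finBasis (R ⧸ I) (M ⧸ radicalSubmodule G π M)
  have hcard : Fintype.card (Fin (Module.finrank (R ⧸ I) (M ⧸ radicalSubmodule G π M))) ≤
      Fintype.card ι := by
    rw [Fintype.card_fin]
    exact h
  obtain ⟨e⟩ := Function.Embedding.nonempty_of_card_le hcard
  -- The family lifts a basis of the quotient; surplus indices lift the zero vector.
  choose w hw using fun j => Submodule.Quotient.mk_surjective _ (Function.extend e b 0 j)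
  refine ⟨w, ?_⟩
  rw [span_range_sup_eq_top_iff I, eq_top_iff, ← b.span_eq]
  refine Submodule.span_mono ?_
  rintro _ ⟨j, rfl⟩
  exact ⟨e j, (hw _).trans (e.injective.extend_apply _ _ _)⟩


theorem rankRG_eq_of_exact_of_isCohomologicallyTrivial [Finite G] [IsDomain R]
    [IsPrincipalIdealRing R] [CharZero R] [Nontrivial (R ⧸ Ideal.span {π})] [Finite A]
    [Module.Free (MonoidAlgebra R G) L] [Module.Finite (MonoidAlgebra R G) L]
    (i : M →ₗ[MonoidAlgebra R G] L) (q : L →ₗ[MonoidAlgebra R G] A)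
    (hi : Function.Injective i) (hiq : Function.Exact i q) (hq : Function.Surjective q)
    (hA : IsCohomologicallyTrivial (Representation.ofModule' (k := R) (G := G) A)) :
    rankRG G π M = rankRG G π L := by
  have := Fintype.ofFinite G
  have : Module.Free R L := Module.Free.trans (S := MonoidAlgebra R G)
  have : Module.Finite R L := Module.Finite.trans (MonoidAlgebra R G) L
  have : Module.Finite R M := Module.Finite.of_injective (i.restrictScalars R) hi
  have : Module.IsTorsionFree R M := hi.moduleIsTorsionFree (i.restrictScalars R) (by simp)
  have hL := IsCohomologicallyTrivial.of_free (R := R) (G := G) (L := L)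
  have hM := IsCohomologicallyTrivial.of_exact_left i q hi hiq hq hL hA
  rw [rankRG_eq_finrank_range_normMap π fun x hx => hM.mem_commutatorSubmodule x
      ((normMap_apply x).symm.trans hx),
    rankRG_eq_finrank_range_normMap π fun x hx => hL.mem_commutatorSubmodule x
      ((normMap_apply x).symm.trans hx)]
  have hcomm : ∀ x, i (normMap R G M x) = normMap R G L (i x) := by
    intro x
    simp [normMap_apply]
  have h1 : Module.finrank R M = Module.finrank R L :=
    LinearMap.finrank_eq_of_exact_of_finite (i.restrictScalars R) (q.restrictScalars R) hi hiq
  -- The map i embeds ker N on M into ker N on L, and the cokernel embeds in the finite module A.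
  have h2 : Module.finrank R (LinearMap.ker (normMap R G M)) =
      Module.finrank R (LinearMap.ker (normMap R G L)) := by
    refine LinearMap.finrank_eq_of_exact_of_finite
      ((i.restrictScalars R).restrict fun x hx => ?_)
      (q.restrictScalars R ∘ₗ Submodule.subtype _) ?_ ?_
    · rw [LinearMap.mem_ker] at hx ⊢
      rw [LinearMap.restrictScalars_apply, ← hcomm, hx, map_zero]
    · intro x y hxy
      exact Subtype.ext (hi (congrArg Subtype.val hxy))
    · rintro ⟨y, hy⟩
      constructor
      · intro h
        obtain ⟨x, rfl⟩ := (hiq y).1 h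
        refine ⟨⟨x, hi ?_⟩, rfl⟩
        rw [hcomm, map_zero]
        exact hy
      · rintro ⟨x, hx⟩
        exact (hiq y).2 ⟨x, congrArg Subtype.val hx⟩
  have h3 := (LinearMap.ker (normMap R G M)).finrank_quotient_add_finrank
  have h4 := (LinearMap.ker (normMap R G L)).finrank_quotient_add_finrank
  rw [(LinearMap.quotKerEquivRange _).finrank_eq] at h3 h4
  omega

/-- If `M ⊆ L` has finite index, `L` is free and `M` needs no more generators than `L`, then
`M ≅ L`. -/
theorem nonempty_linearEquiv_of_rankRG_eq (p : ℕ) [Fact p.Prime] [Finite G] (hG : IsPGroup p G)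
    (hjac : Ideal.span {π} ≤ Ideal.jacobson ⊥) (hmax : (Ideal.span {π}).IsMaximal)
    [Finite (R ⧸ Ideal.span {π})] (hp : (p : R) ∈ Ideal.span {π}) [IsDomain R]
    [IsPrincipalIdealRing R] [CharZero R] [Finite A]
    [Module.Free (MonoidAlgebra R G) L] [Module.Finite (MonoidAlgebra R G) L]
    (i : M →ₗ[MonoidAlgebra R G] L) (q : L →ₗ[MonoidAlgebra R G] A)
    (hi : Function.Injective i) (hiq : Function.Exact i q)
    (h : rankRG G π M = rankRG G π L) : Nonempty (L ≃ₗ[MonoidAlgebra R G] M) := by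
  have : Module.Free R L := Module.Free.trans (S := MonoidAlgebra R G)
  have : Module.Finite R L := Module.Finite.trans (MonoidAlgebra R G) L
  have : Module.Finite R M := Module.Finite.of_injective (i.restrictScalars R) hi
  have : Nontrivial (R ⧸ Ideal.span {π}) := Ideal.Quotient.nontrivial_iff.2 hmax.ne_top
  let b := Module.Free.chooseBasis (MonoidAlgebra R G) L
  -- This inequality lets generators of M be indexed by the basis of L; equality is not needed.
  have hL := rankRG_le_card π b (eq_top_iff.2
    ((span_range_basis_sup_commutatorSubmodule b).ge.trans (sup_le_sup le_rfl le_sup_right)))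
  obtain ⟨v, hv⟩ := exists_span_sup_radicalSubmodule (M := M) π hmax (h.trans_le hL)
  let φ : L →ₗ[MonoidAlgebra R G] M := b.constr ℕ v
  have hφ : Function.Surjective φ := by
    rw [← LinearMap.range_eq_top]
    refine Submodule.eq_top_of_sup_radicalSubmodule π p hG hjac hmax hp _ (eq_top_iff.2 ?_)
    rw [← hv]
    refine sup_le_sup (Submodule.span_le.2 ?_) le_rfl
    rintro _ ⟨j, rfl⟩
    exact ⟨b j, b.constr_basis ℕ v j⟩
  have hr : Module.finrank R M = Module.finrank R L :=
    LinearMap.finrank_eq_of_exact_of_finite (i.restrictScalars R) (q.restrictScalars R) hi hiq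
  -- A surjection between modules of equal rank has a kernel of rank zero, which is free as a
  -- submodule of a free R-module, hence zero.
  have hk := (LinearMap.ker (φ.restrictScalars R)).finrank_quotient_add_finrank
  rw [((φ.restrictScalars R).quotKerEquivOfSurjective hφ).finrank_eq, hr, add_eq_left,
    Module.finrank_eq_zero_iff_of_free] at hk
  refine ⟨LinearEquiv.ofBijective φ ⟨(injective_iff_map_eq_zero φ).2 fun x hx => ?_, hφ⟩⟩
  exact congrArg Subtype.val (Subsingleton.elim (⟨x, hx⟩ : LinearMap.ker (φ.restrictScalars R)) 0)

/-- A finite `RG`-module is a quotient of a free module of finite rank. -/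
theorem MonoidAlgebra.exists_finite_free_surjective (R G A : Type u) [CommRing R] [Group G]
    [AddCommGroup A] [Module (MonoidAlgebra R G) A] [Finite A] :
    ∃ q : (A → MonoidAlgebra R G) →ₗ[MonoidAlgebra R G] A, Function.Surjective q := by
  classical
  have := Fintype.ofFinite A
  refine ⟨Fintype.linearCombination (MonoidAlgebra R G) id, fun a => ⟨Pi.single a 1, ?_⟩⟩
  rw [Fintype.linearCombination_apply_single, one_smul, id]

end

/-! ### The equivalence -/

/-- `p` is a prime, `K` a finite extension of `ℚ_p` with ring of integers `R`, `π` a uniformizing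
element of `R`, `G` a finite `p`-group and `A` a finite `RG`-module. -/
theorem corollary3 (p : ℕ) [Fact p.Prime]
    {K : Type*} [Field K] [Algebra ℚ_[p] K] [FiniteDimensional ℚ_[p] K]
    [Algebra ℤ_[p] K] [IsScalarTower ℤ_[p] ℚ_[p] K]
    {R : Type u} [CommRing R] [Algebra ℤ_[p] R] [Algebra R K] [IsScalarTower ℤ_[p] R K]
    [IsIntegralClosure R ℤ_[p] K]
    (π : R) (hπ : Irreducible π)
    {G : Type u} [Group G] [Finite G] (hG : IsPGroup p G)
    {A : Type u} [AddCommGroup A] [Module R A] [Module (MonoidAlgebra R G) A]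
    [IsScalarTower R (MonoidAlgebra R G) A] [Finite A] :
    IsCohomologicallyTrivial (Representation.ofModule' (k := R) (G := G) A) ↔
      ∀ (M L : Type u)
        [AddCommGroup M] [Module R M] [Module (MonoidAlgebra R G) M]
        [IsScalarTower R (MonoidAlgebra R G) M]
        [AddCommGroup L] [Module R L] [Module (MonoidAlgebra R G) L]
        [IsScalarTower R (MonoidAlgebra R G) L]
        [Module.Free (MonoidAlgebra R G) L] [Module.Finite (MonoidAlgebra R G) L]
        (i : M →ₗ[MonoidAlgebra R G] L) (q : L →ₗ[MonoidAlgebra R G] A),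
        Function.Injective i → Function.Exact i q → Function.Surjective q →
          rankRG G π M = rankRG G π L := by
  have := PadicInt.isDomain_of_isIntegralClosure p K R
  have := PadicInt.isLocalRing_of_isIntegralClosure p K R
  have := PadicInt.isPrincipalIdealRing_of_isIntegralClosure p K R
  have hmaxid := PadicInt.maximalIdeal_eq_span_of_irreducible p K hπ
  have hmax : (Ideal.span {π}).IsMaximal := hmaxid ▸ IsLocalRing.maximalIdeal.isMaximal R
  have hjac : Ideal.span {π} ≤ Ideal.jacobson ⊥ := by
    rw [← hmaxid, IsLocalRing.jacobson_eq_maximalIdeal ⊥ bot_ne_top]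
  have := PadicInt.finite_quotient_span_irreducible p K hπ
  have hp := PadicInt.natCast_mem_span_irreducible p K hπ
  have : CharZero K := charZero_of_injective_algebraMap (algebraMap ℚ_[p] K).injective
  have : CharZero R := ⟨fun m n hmn => Nat.cast_injective (R := K) (by
    simpa using congrArg (algebraMap R K) hmn)⟩
  have : Nontrivial (R ⧸ Ideal.span {π}) := Ideal.Quotient.nontrivial_iff.2 hmax.ne_top
  constructor
  · intro hA M L _ _ _ _ _ _ _ _ _ _ i q hi hiq hq
    exact rankRG_eq_of_exact_of_isCohomologicallyTrivial π i q hi hiq hq hA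
  · intro H
    -- The rank condition for this single presentation already suffices.
    obtain ⟨q, hq⟩ := MonoidAlgebra.exists_finite_free_surjective R G A
    let i := (LinearMap.ker q).subtype
    have hi : Function.Injective i := Subtype.val_injective
    have hiq : Function.Exact i q := LinearMap.exact_subtype_ker_map q
    obtain ⟨e⟩ := nonempty_linearEquiv_of_rankRG_eq π p hG hjac hmax hp i q hi hiq
      (H _ _ i q hi hiq hq)
    have : Module.Free (MonoidAlgebra R G) (LinearMap.ker q) := Module.Free.of_equiv e
    exact .of_exact_right i q hi hiq hq .of_free .of_free
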